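/- Let $(\mathcal{A},\mathbb{E},\mathfrak{s})$ be an extriangulated category in the sense of Nakaoka and Palu (an additive category $\mathcal{A}$, an additive bifunctor $\mathbb{E}:\mathcal{A}^{\mathrm{op}}\times\mathcal{A}\to\mathrm{Ab}$ and an additive realization $\mathfrak{s}$ satisfying (ET3), (ET3)$^{\mathrm{op}}$, (ET4), (ET4)$^{\mathrm{op}}$). An $\mathbb{E}$-triangle $X\xrightarrow{x}L\xrightarrow{y}M\overset{\delta}{\dashrightarrow}$ consists of $\delta\in\mathbb{E}(M,X)$ and a sequence with $\mathfrak{s}(\delta)=[X\xrightarrow{x}L\xrightarrow{y}M]$; then $x$ is called an inflation with cone $M$. A *length function* on $\mathcal{A}$ is a map $\Theta$ from the isomorphism classes of objects of $\mathcal{A}$ to $\mathbb{N}=\{0,1,2,\dots\}$ such that $\Theta(X)=0$ if and only if $X\cong 0$, and such that for every $\mathbb{E}$-triangle $X\to L\to M\overset{\delta}{\dashrightarrow}$ one has $\Theta(L)\le\Theta(X)+\Theta(M)$, with equality if $\delta=0$. An $\mathbb{E}$-triangle $X\xrightarrow{x}L\xrightarrow{y}M\dashrightarrow$ is *$\Theta$-stable*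 if $\Theta(L)=\Theta(X)+\Theta(M)$; in this case $x$ is a *$\Theta$-inflation* and $y$ a *$\Theta$-deflation*. The pair $(\mathcal{A},\Theta)$ is a *length category* if $\Theta$ is a length function and every morphism $f$ of $\mathcal{A}$ factors as $f=j\circ i$ with $i$ a $\Theta$-deflation and $j$ a $\Theta$-inflation; $\mathcal{A}$ is a *length category* if $(\mathcal{A},\Theta)$ is one for some $\Theta$. A *semibrick* is a set $\mathcal{X}$ of isomorphism classes of objects whose endomorphism rings are division rings, with $\operatorname{Hom}(X,Y)=0$ for all non-isomorphic $X,Y\in\mathcal{X}$. It is a *simple-minded system* if every object $M$ of $\mathcal{A}$ has a finite filtration $0=M_0\to M_1\to\cdots\to M_n=M$ by inflations with cones in $\mathcal{X}$. For a length category $(\mathcal{A},\Theta)$, let $\Theta_1$ be the set of isomorphism classes of non-zero objects $M$ with $\Theta(M)\le\Theta(N)$ for all non-zero $N\in\mathcal{A}$. For $n\ge 2$, let $\Theta_n$ be the union of $\Theta_{n-1}$ and the set of isomorphism classes of all $M$ with $\Theta(M)=n$ and $\operatorname{Hom}(X,M)=0=\operatorname{Hom}(M,X)$ for all $X\in\Theta_{n-1}$.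 Put $\Theta_\infty=\bigcup_{n\ge1}\Theta_n$. **Theorem.** The following are equivalent: 1. $\mathcal{A}$ is a length category; 2. $\mathcal{A}$ has a simple-minded system. Moreover, if $(\mathcal{A},\Theta)$ is a length category, then $\Theta_\infty$ is a simple-minded system in $\mathcal{A}$. -/

import Mathlib

open CategoryTheory CategoryTheory.Limits Opposite

universe w v u

/-- An extriangulated structure `(𝔼, 𝔰)` in the sense of Nakaoka and Palu on an additive category
`C`. The correspondence `𝔰`, which sends `δ ∈ 𝔼(Z, X)` to an equivalence class of sequences
`X ⟶ Y ⟶ Z`, is given by the predicate `Realizes x y δ`, "the sequence `(x, y)` belongs to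
`𝔰(δ)`"; the three fields `exists_realizes`, `realizes_of_iso` and `exists_iso_of_realizes` say
that the sequences realizing a given `δ` form exactly one equivalence class. -/
structure ExtriangulatedStructure (C : Type u) [Category.{v} C] [Preadditive C] [HasZeroObject C]
    [HasBinaryBiproducts C] where
  /-- The bifunctor `𝔼 : Cᵒᵖ × C ⥤ Ab`; `(E.obj (op Z)).obj X` is `𝔼(Z, X)`. -/
  E : Cᵒᵖ ⥤ C ⥤ AddCommGrpCat.{w}
  additive_right : ∀ Z : Cᵒᵖ, (E.obj Z).Additive
  additive_left : ∀ X : C, (E.flip.obj X).Additive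
  /-- `Realizes x y δ` means `𝔰(δ) = [X ⟶ Y ⟶ Z]`. -/
  Realizes : ∀ {X Y Z : C}, (X ⟶ Y) → (Y ⟶ Z) → ((E.obj (op Z)).obj X) → Prop
  exists_realizes : ∀ {X Z : C} (δ : (E.obj (op Z)).obj X),
    ∃ (Y : C) (x : X ⟶ Y) (y : Y ⟶ Z), Realizes x y δ
  realizes_of_iso : ∀ {X Y Y' Z : C} {x : X ⟶ Y} {y : Y ⟶ Z} {x' : X ⟶ Y'} {y' : Y' ⟶ Z}
    {δ : (E.obj (op Z)).obj X} (e : Y ≅ Y'), x ≫ e.hom = x' → e.hom ≫ y' = y →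
      Realizes x y δ → Realizes x' y' δ
  exists_iso_of_realizes : ∀ {X Y Y' Z : C} {x : X ⟶ Y} {y : Y ⟶ Z} {x' : X ⟶ Y'} {y' : Y' ⟶ Z}
    {δ : (E.obj (op Z)).obj X}, Realizes x y δ → Realizes x' y' δ →
      ∃ e : Y ≅ Y', x ≫ e.hom = x' ∧ e.hom ≫ y' = y
  /-- `𝔰` is a realization: every morphism of extensions `(a, c) : δ ⟶ δ'`, that is
  `a_* δ = c^* δ'`, lifts to a morphism of realizing sequences. -/
  exists_middle : ∀ {X Y Z X' Y' Z' : C} {x : X ⟶ Y} {y : Y ⟶ Z} {δ : (E.obj (op Z)).obj X}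
    {x' : X' ⟶ Y'} {y' : Y' ⟶ Z'} {δ' : (E.obj (op Z')).obj X'},
    Realizes x y δ → Realizes x' y' δ' → ∀ (a : X ⟶ X') (c : Z ⟶ Z'),
      (E.obj (op Z)).map a δ = (E.map c.op).app X' δ' →
      ∃ b : Y ⟶ Y', x ≫ b = a ≫ x' ∧ b ≫ y' = y ≫ c
  /-- `𝔰(0)` is the class of the split sequence. -/
  realizes_zero : ∀ X Z : C,
    Realizes (biprod.inl : X ⟶ X ⊞ Z) (biprod.snd : X ⊞ Z ⟶ Z) 0
  /-- `𝔰(δ ⊕ δ') = 𝔰(δ) ⊕ 𝔰(δ')`, where `δ ⊕ δ' ∈ 𝔼(Z ⊞ Z', X ⊞ X')` is the extension with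
  components `(δ, 0, 0, δ')`. -/
  realizes_biprod : ∀ {X Y Z X' Y' Z' : C} {x : X ⟶ Y} {y : Y ⟶ Z} {δ : (E.obj (op Z)).obj X}
    {x' : X' ⟶ Y'} {y' : Y' ⟶ Z'} {δ' : (E.obj (op Z')).obj X'},
    Realizes x y δ → Realizes x' y' δ' →
      Realizes (biprod.map x x') (biprod.map y y')
        ((E.obj (op (Z ⊞ Z'))).map (biprod.inl : X ⟶ X ⊞ X')
            ((E.map (biprod.fst : Z ⊞ Z' ⟶ Z).op).app X δ) +
          (E.obj (op (Z ⊞ Z'))).map (biprod.inr : X' ⟶ X ⊞ X')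
            ((E.map (biprod.snd : Z ⊞ Z' ⟶ Z').op).app X' δ'))
  /-- (ET3) -/
  et3 : ∀ {X Y Z X' Y' Z' : C} {x : X ⟶ Y} {y : Y ⟶ Z} {δ : (E.obj (op Z)).obj X}
    {x' : X' ⟶ Y'} {y' : Y' ⟶ Z'} {δ' : (E.obj (op Z')).obj X'},
    Realizes x y δ → Realizes x' y' δ' → ∀ (a : X ⟶ X') (b : Y ⟶ Y'), x ≫ b = a ≫ x' →
      ∃ c : Z ⟶ Z', b ≫ y' = y ≫ c ∧ (E.obj (op Z)).map a δ = (E.map c.op).app X' δ'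
  /-- (ET3)ᵒᵖ -/
  et3_op : ∀ {X Y Z X' Y' Z' : C} {x : X ⟶ Y} {y : Y ⟶ Z} {δ : (E.obj (op Z)).obj X}
    {x' : X' ⟶ Y'} {y' : Y' ⟶ Z'} {δ' : (E.obj (op Z')).obj X'},
    Realizes x y δ → Realizes x' y' δ' → ∀ (b : Y ⟶ Y') (c : Z ⟶ Z'), b ≫ y' = y ≫ c →
      ∃ a : X ⟶ X', x ≫ b = a ≫ x' ∧ (E.obj (op Z)).map a δ = (E.map c.op).app X' δ'
  /-- (ET4) -/
  et4 : ∀ {A B B₁ D F : C} {f : A ⟶ B} {f' : B ⟶ D} {δ : (E.obj (op D)).obj A}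
    {g : B ⟶ B₁} {g' : B₁ ⟶ F} {δ' : (E.obj (op F)).obj B},
    Realizes f f' δ → Realizes g g' δ' →
      ∃ (G : C) (h' : B₁ ⟶ G) (d : D ⟶ G) (e : G ⟶ F) (δ'' : (E.obj (op G)).obj A),
        g ≫ h' = f' ≫ d ∧ h' ≫ e = g' ∧
        Realizes (f ≫ g) h' δ'' ∧
        Realizes d e ((E.obj (op F)).map f' δ') ∧
        (E.map d.op).app A δ'' = δ ∧
        (E.obj (op G)).map f δ'' = (E.map e.op).app B δ'
  /-- (ET4)ᵒᵖ -/
  et4_op : ∀ {A B B₁ D F : C} {f' : D ⟶ A} {f : A ⟶ B} {δ : (E.obj (op B)).obj D}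
    {g' : F ⟶ B} {g : B ⟶ B₁} {δ' : (E.obj (op B₁)).obj F},
    Realizes f' f δ → Realizes g' g δ' →
      ∃ (G : C) (h' : G ⟶ A) (d : D ⟶ G) (e : G ⟶ F) (δ'' : (E.obj (op B₁)).obj G),
        h' ≫ f = e ≫ g' ∧ d ≫ h' = f' ∧
        Realizes h' (f ≫ g) δ'' ∧
        Realizes d e ((E.map g'.op).app D δ) ∧
        (E.obj (op B₁)).map e δ'' = δ' ∧
        (E.obj (op B)).map d δ = (E.map g.op).app G δ''

namespace ExtriangulatedStructure

variable {C : Type u} [Category.{v} C] [Preadditive C] [HasZeroObject C] [HasBinaryBiproducts C]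
  (T : ExtriangulatedStructure.{w} C)

/-- A length function, as an isomorphism-invariant map from the objects of `C` to `ℕ`. -/
structure IsLengthFunction (Θ : C → ℕ) : Prop where
  iso : ∀ {X Y : C}, (X ≅ Y) → Θ X = Θ Y
  eq_zero_iff : ∀ X : C, Θ X = 0 ↔ IsZero X
  le_add : ∀ {X L M : C} {x : X ⟶ L} {y : L ⟶ M} {δ : (T.E.obj (op M)).obj X},
    T.Realizes x y δ → Θ L ≤ Θ X + Θ M
  eq_add_of_split : ∀ {X L M : C} {x : X ⟶ L} {y : L ⟶ M},
    T.Realizes x y 0 → Θ L = Θ X + Θ M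

/-- `x` is a `Θ`-inflation: the first morphism of a `Θ`-stable `𝔼`-triangle. -/
def IsInflationFor (Θ : C → ℕ) {X L : C} (x : X ⟶ L) : Prop :=
  ∃ (M : C) (y : L ⟶ M) (δ : (T.E.obj (op M)).obj X),
    T.Realizes x y δ ∧ Θ L = Θ X + Θ M

/-- `y` is a `Θ`-deflation: the second morphism of a `Θ`-stable `𝔼`-triangle. -/
def IsDeflationFor (Θ : C → ℕ) {L M : C} (y : L ⟶ M) : Prop :=
  ∃ (X : C) (x : X ⟶ L) (δ : (T.E.obj (op M)).obj X),
    T.Realizes x y δ ∧ Θ L = Θ X + Θ M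

/-- `f` is `Θ`-admissible: a `Θ`-deflation followed by a `Θ`-inflation. -/
def IsAdmissibleFor (Θ : C → ℕ) {M N : C} (f : M ⟶ N) : Prop :=
  ∃ (X : C) (i : M ⟶ X) (j : X ⟶ N),
    T.IsDeflationFor Θ i ∧ T.IsInflationFor Θ j ∧ i ≫ j = f

/-- `(C, Θ)` is an extriangulated length category. -/
def IsLengthCategoryWith (Θ : C → ℕ) : Prop :=
  T.IsLengthFunction Θ ∧ ∀ {M N : C} (f : M ⟶ N), T.IsAdmissibleFor Θ f

/-- `C` is an extriangulated length category. -/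
def IsLengthCategory : Prop := ∃ Θ : C → ℕ, T.IsLengthCategoryWith Θ

/-- The objects with a finite filtration `0 = M₀ ⟶ M₁ ⟶ ⋯ ⟶ Mₙ = M` by inflations whose cones
belong to `𝒳`. -/
inductive Filt (𝒳 : ObjectProperty C) : ObjectProperty C
  | zero {M : C} : IsZero M → Filt 𝒳 M
  | step {M M' X : C} {f : M ⟶ M'} {g : M' ⟶ X} {δ : (T.E.obj (op X)).obj M} :
      Filt 𝒳 M → T.Realizes f g δ → 𝒳 X → Filt 𝒳 M'

/-- The endomorphism ring of `X` is a division ring. -/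
def IsBrick (X : C) : Prop :=
  Nontrivial (End X) ∧ ∀ f : End X, f ≠ 0 → IsUnit f

/-- A semibrick; a set of isomorphism classes is an isomorphism-closed property of objects. -/
structure IsSemibrick (𝒳 : ObjectProperty C) : Prop where
  iso_closed : 𝒳.IsClosedUnderIsomorphisms
  brick : ∀ X : C, 𝒳 X → IsBrick X
  hom_eq_zero : ∀ X Y : C, 𝒳 X → 𝒳 Y → IsEmpty (X ≅ Y) → ∀ f : X ⟶ Y, f = 0

/-- A simple-minded system: a semibrick `𝒳` with `C = Filt(𝒳)`. -/
def IsSimpleMindedSystem (𝒳 : ObjectProperty C) : Prop :=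
  IsSemibrick 𝒳 ∧ ∀ M : C, T.Filt 𝒳 M

/-- The sets `Θₙ` for `n ≥ 1` (the value at `0` is a placeholder): `Θ₁` consists of the non-zero
objects of minimal length, and `Θₙ` is the union of `Θₙ₋₁` and the set of objects `M` with
`Θ(M) = n` that have no non-zero morphism to or from an object of `Θₙ₋₁`. -/
def thetaLevel (Θ : C → ℕ) : ℕ → ObjectProperty C
  | 0 => fun _ => False
  | 1 => fun M => ¬ IsZero M ∧ ∀ N : C, ¬ IsZero N → Θ M ≤ Θ N
  | n + 2 => fun M => thetaLevel Θ (n + 1) M ∨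
      ((thetaLevel Θ (n + 1)).rightOrthogonal M ∧ (thetaLevel Θ (n + 1)).leftOrthogonal M ∧
        Θ M = n + 2)

/-- The union `Θ_∞` of the sets `Θₙ`, `n ≥ 1`. -/
def thetaInfty (Θ : C → ℕ) : ObjectProperty C :=
  fun M => ∃ n : ℕ, 1 ≤ n ∧ thetaLevel Θ n M

end ExtriangulatedStructure

namespace ExtriangulatedStructure

/-! From a length to a system: the objects of `Θₙ` are simple, i.e. they have no `Θ`-stable
decomposition with non-zero ends. As every morphism is admissible, Schur's lemma holds for simple
objects (`IsSimpleFor.isIso_of_ne_zero`), which makes `Θ_∞` a semibrick. An object not orthogonal to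
`Θₙ` has a simple stable subobject or quotient with shorter complement, so induction on length
filters every object (`filt_thetaLevel`).

From a system `𝒳` to a length: take the least number of steps of an `𝒳`-filtration. A non-zero
morphism from an object of `𝒳` is an inflation whose cone needs one step fewer
(`FiltN.exists_realizes_of_ne_zero`); uniqueness of cones then gives additivity on biproducts
(`FiltN.exists_of_biprod`). To factor `f`, divide out morphisms from `𝒳` killed by `f`; once none is
left, `f` is a stable inflation (`isInflationFor_filtLength`). -/

lemma isIso_of_sub_comp_self_eq_zero {C : Type u} [Category.{v} C] [Preadditive C] {A : C} (f : A ⟶ A) (hf : (𝟙 A - f) ≫ (𝟙 A - f) = 0) :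
    IsIso f := by
  refine ⟨𝟙 A + (𝟙 A - f), ?_, ?_⟩ <;>
  · simp only [Preadditive.comp_sub, Preadditive.sub_comp, Category.comp_id, Category.id_comp,
      Preadditive.comp_add, Preadditive.add_comp] at hf ⊢
    rw [← sub_eq_zero, ← neg_eq_zero, ← hf]
    abel

lemma isIso_of_isIso_comp_of_isIso_comp {C : Type u} [Category.{v} C] {A B : C} (f : A ⟶ B) (g : B ⟶ A) [IsIso (f ≫ g)]
    [IsIso (g ≫ f)] : IsIso f := by
  have : Mono f := mono_of_mono f g
  have : IsSplitEpi f := ⟨⟨inv (g ≫ f) ≫ g, by simp⟩⟩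
  exact isIso_of_mono_of_isSplitEpi f

variable {C : Type u} [Category.{v} C] [Preadditive C] [HasZeroObject C] [HasBinaryBiproducts C]
  (T : ExtriangulatedStructure.{w} C)

/-! ### Elementary properties of `𝔼`-triangles -/

section Basic

open scoped ZeroObject

lemma extension_eq_zero_of_isZero_left {X Z : C} (hX : IsZero X) (δ : (T.E.obj (op Z)).obj X) :
    δ = 0 := by
  have := T.additive_right (op Z)
  have h : (T.E.obj (op Z)).map (𝟙 X) = 0 := by
    rw [hX.eq_of_src (𝟙 X) 0, Functor.map_zero]
  have := congrArg (fun φ => φ.hom δ) h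
  simpa using this

lemma extension_eq_zero_of_isZero_right {X Z : C} (hZ : IsZero Z) (δ : (T.E.obj (op Z)).obj X) :
    δ = 0 := by
  have := T.additive_left X
  have h : (T.E.flip.obj X).map (𝟙 Z).op = 0 := by
    rw [hZ.eq_of_src (𝟙 Z) 0, op_zero, Functor.map_zero]
  have := congrArg (fun φ => φ.hom δ) h
  simpa using this

lemma map_op_zero_app {X Z Z' : C} (δ : (T.E.obj (op Z')).obj X) :
    (T.E.map (0 : Z ⟶ Z').op).app X δ = 0 := by
  have := T.additive_left X
  have h : (T.E.flip.obj X).map (0 : Z ⟶ Z').op = 0 := by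
    rw [op_zero, Functor.map_zero]
  have := congrArg (fun φ => φ.hom δ) h
  simpa using this

lemma map_op_id_app {X Z : C} (δ : (T.E.obj (op Z)).obj X) :
    (T.E.map (𝟙 Z).op).app X δ = δ := by
  simp

lemma map_op_comp_app {X Z Z' Z'' : C} (f : Z ⟶ Z') (g : Z' ⟶ Z'') (δ : (T.E.obj (op Z'')).obj X) :
    (T.E.map (f ≫ g).op).app X δ = (T.E.map f.op).app X ((T.E.map g.op).app X δ) := by
  simp

lemma map_op_sub_app {X Z Z' : C} (f g : Z ⟶ Z') (δ : (T.E.obj (op Z')).obj X) :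
    (T.E.map (f - g).op).app X δ = (T.E.map f.op).app X δ - (T.E.map g.op).app X δ := by
  have := T.additive_left X
  have h : (T.E.flip.obj X).map (f - g).op =
      (T.E.flip.obj X).map f.op - (T.E.flip.obj X).map g.op := by
    rw [op_sub, Functor.map_sub]
  have := congrArg (fun φ => φ.hom δ) h
  simpa using this

variable {T}

lemma realizes_of_isZero_left {K : C} (hK : IsZero K) (W : C) :
    T.Realizes (0 : K ⟶ W) (𝟙 W) 0 := by
  refine T.realizes_of_iso (x := biprod.inl) (y := biprod.snd) (Y := K ⊞ W)
    ⟨biprod.snd, biprod.inr, ?_, by simp⟩ (by simp) (by simp) (T.realizes_zero K W)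
  ext
  · exact hK.eq_of_src _ _
  · exact hK.eq_of_src _ _
  · simp
  · simp

lemma realizes_of_isZero_right {K : C} (hK : IsZero K) (W : C) :
    T.Realizes (𝟙 W) (0 : W ⟶ K) 0 := by
  refine T.realizes_of_iso (x := biprod.inl) (y := biprod.snd) (Y := W ⊞ K)
    ⟨biprod.fst, biprod.inl, ?_, by simp⟩ (by simp) (hK.eq_of_tgt _ _) (T.realizes_zero W K)
  ext
  · simp
  · simp
  · exact hK.eq_of_src _ _
  · exact hK.eq_of_src _ _

variable {X L M : C} {x : X ⟶ L} {y : L ⟶ M} {δ : (T.E.obj (op M)).obj X}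

lemma Realizes.comp_eq_zero (h : T.Realizes x y δ) : x ≫ y = 0 := by
  obtain ⟨c, hc, -⟩ := T.et3 (realizes_of_isZero_right (isZero_zero C) X) h (𝟙 X) x rfl
  simpa using hc

/-- Compare with the trivial triangle `W = W ⟶ 0`: this makes `x` a weak kernel of `y`; uniqueness
of the lift is not available. -/
lemma Realizes.exists_lift (h : T.Realizes x y δ) {W : C} (g : W ⟶ L) (hg : g ≫ y = 0) :
    ∃ a : W ⟶ X, a ≫ x = g := by
  obtain ⟨a, ha, -⟩ := T.et3_op (realizes_of_isZero_right (isZero_zero C) W) h g 0 (by simp [hg])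
  exact ⟨a, by simpa using ha.symm⟩

lemma Realizes.exists_desc (h : T.Realizes x y δ) {W : C} (g : L ⟶ W) (hg : x ≫ g = 0) :
    ∃ c : M ⟶ W, y ≫ c = g := by
  obtain ⟨c, hc, -⟩ := T.et3 h (realizes_of_isZero_left (isZero_zero C) W) 0 g (by simp [hg])
  exact ⟨c, by simpa using hc.symm⟩

/-- A morphism to the third term lifts to the middle term if the extension pulls back to zero. -/
lemma Realizes.exists_lift_of_pullback_eq_zero (h : T.Realizes x y δ) {W : C} (g : W ⟶ M)
    (hg : (T.E.map g.op).app X δ = 0) : ∃ b : W ⟶ L, b ≫ y = g := by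
  obtain ⟨b, -, hb⟩ := T.exists_middle (realizes_of_isZero_left (isZero_zero C) W) h 0 g
    (by rw [hg, map_zero])
  exact ⟨b, by simpa using hb⟩

lemma Realizes.eq_zero_of_section (h : T.Realizes x y δ) (s : M ⟶ L) (hs : s ≫ y = 𝟙 M) :
    δ = 0 := by
  obtain ⟨a, -, ha⟩ := T.et3_op (realizes_of_isZero_left (isZero_zero C) M) h s (𝟙 M)
    (by simp [hs])
  rw [map_zero, map_op_id_app] at ha
  exact ha.symm

lemma Realizes.exists_biprod_iso (h : T.Realizes x y 0) :
    ∃ e : L ≅ X ⊞ M, x ≫ e.hom = biprod.inl ∧ e.hom ≫ biprod.snd = y :=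
  T.exists_iso_of_realizes h (T.realizes_zero X M)

lemma Realizes.isIso_of_isZero_right (h : T.Realizes x y δ) (hM : IsZero M) : IsIso x := by
  obtain rfl := T.extension_eq_zero_of_isZero_right hM δ
  obtain ⟨e, he, -⟩ := T.exists_iso_of_realizes (realizes_of_isZero_right hM X)
    (x' := x) (y' := y) h
  rw [Category.id_comp] at he
  rw [← he]; infer_instance

lemma Realizes.isIso_of_isZero_left (h : T.Realizes x y δ) (hX : IsZero X) : IsIso y := by
  obtain rfl := T.extension_eq_zero_of_isZero_left hX δ
  obtain ⟨e, -, he⟩ := T.exists_iso_of_realizes h (realizes_of_isZero_left hX M)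
  rw [Category.comp_id] at he
  rw [← he]; infer_instance

/-- The cone of an inflation is unique up to isomorphism. -/
lemma Realizes.nonempty_iso_cone (h : T.Realizes x y δ) {M' : C} {y' : L ⟶ M'}
    {δ' : (T.E.obj (op M')).obj X} (h' : T.Realizes x y' δ') : Nonempty (M ≅ M') := by
  -- Since `𝟙 - c ≫ c'` pulls `ε` back to zero, it lifts through `z`; as `z` composed with it
  -- vanishes, its square is zero.
  have key : ∀ {N N' : C} {z : L ⟶ N} {z' : L ⟶ N'} {ε : (T.E.obj (op N)).obj X}
      {ε' : (T.E.obj (op N')).obj X} (_ : T.Realizes x z ε) (c : N ⟶ N') (c' : N' ⟶ N),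
      z' = z ≫ c → z = z' ≫ c' → ε = (T.E.map c.op).app X ε' →
      ε' = (T.E.map c'.op).app X ε → IsIso (c ≫ c') := by
    intro N N' z z' ε ε' hz c c' h1 h2 h3 h4
    obtain ⟨t, ht⟩ := hz.exists_lift_of_pullback_eq_zero (𝟙 N - c ≫ c') (by
      rw [map_op_sub_app, map_op_id_app, map_op_comp_app, ← h4, ← h3, sub_self])
    refine isIso_of_sub_comp_self_eq_zero _ ?_
    nth_rw 1 [← ht]
    rw [Category.assoc, Preadditive.comp_sub, ← Category.assoc z, ← h1, ← h2, Category.comp_id,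
      sub_self, comp_zero]
  obtain ⟨c, hc, hc'⟩ := T.et3 h h' (𝟙 X) (𝟙 L) (by simp)
  obtain ⟨d, hd, hd'⟩ := T.et3 h' h (𝟙 X) (𝟙 L) (by simp)
  simp only [Category.id_comp, CategoryTheory.Functor.map_id, AddCommGrpCat.hom_id,
    AddMonoidHom.id_apply] at hc hc' hd hd'
  have := key h c d hc hd (by simpa using hc') (by simpa using hd')
  have := key h' d c hd hc (by simpa using hd') (by simpa using hc')
  have := isIso_of_isIso_comp_of_isIso_comp c d
  exact ⟨asIso c⟩

/-- If `f` followed by the deflation `y` is an isomorphism, then `f` is a split inflation whose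
cone is the first term of the `𝔼`-triangle. -/
lemma Realizes.exists_realizes_of_isIso_comp (h : T.Realizes x y δ) {W : C} (f : W ⟶ L)
    [IsIso (f ≫ y)] : ∃ r : L ⟶ X, T.Realizes f r 0 := by
  have hs : (inv (f ≫ y) ≫ f) ≫ y = 𝟙 M := by simp
  obtain rfl := h.eq_zero_of_section _ hs
  obtain ⟨e, he, he'⟩ := h.exists_biprod_iso
  have hxy := h.comp_eq_zero
  have hfy : f ≫ y ≫ inv (f ≫ y) = 𝟙 W := by rw [← Category.assoc, IsIso.hom_inv_id]
  -- The triangle splits, and `r` is the projection of `L` onto `X` along the image of `f`.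
  obtain ⟨r, hr⟩ := h.exists_lift (𝟙 L - y ≫ inv (f ≫ y) ≫ f) (by simp [Preadditive.sub_comp])
  have hx : Mono x := mono_of_mono_fac he
  have hfr : f ≫ r = 0 := by
    rw [← cancel_mono x, Category.assoc, hr, Preadditive.comp_sub, reassoc_of% hfy]
    simp
  have hxr : x ≫ r = 𝟙 X := by
    rw [← cancel_mono x, Category.assoc, hr, Preadditive.comp_sub, reassoc_of% hxy]
    simp
  refine ⟨r, T.realizes_of_iso (x := biprod.inl) (y := biprod.snd) (Y := W ⊞ X)
    ⟨biprod.desc f x, biprod.lift (y ≫ inv (f ≫ y)) r, ?_, ?_⟩ (by simp) ?_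
    (T.realizes_zero W X)⟩
  · ext <;> simp [hfy, hfr, hxr, reassoc_of% hxy]
  · rw [biprod.lift_desc, hr]
    simp
  · ext <;> simp [hfr, hxr]

/-- The composition of an isomorphism and an inflation is an inflation with the same cone. -/
lemma Realizes.exists_of_isIso_comp (h : T.Realizes x y δ) {W : C} (a : W ⟶ X) [IsIso a] :
    ∃ (M' : C) (y' : L ⟶ M') (δ' : (T.E.obj (op M')).obj W),
      T.Realizes (a ≫ x) y' δ' ∧ Nonempty (M' ≅ M) := by
  have ha : T.Realizes a (0 : X ⟶ 0) 0 := T.realizes_of_iso (asIso a) (by simp) (by simp)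
    (realizes_of_isZero_right (isZero_zero C) W)
  obtain ⟨M', y', d, e, δ', -, -, h1, h2, -, -⟩ := T.et4 ha h
  have := h2.isIso_of_isZero_left (isZero_zero C)
  exact ⟨M', y', δ', h1, ⟨asIso e⟩⟩

end Basic

/-! ### Filtrations, extension closure and orthogonality -/

section Filtrations

/-- The objects with a filtration with exactly `n` steps by inflations whose cones belong
to `𝒳`. -/
inductive FiltN (𝒳 : ObjectProperty C) : ℕ → ObjectProperty C
  | zero {M : C} : IsZero M → FiltN 𝒳 0 M
  | step {n : ℕ} {M M' X : C} {f : M ⟶ M'} {g : M' ⟶ X} {δ : (T.E.obj (op X)).obj M} :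
      FiltN 𝒳 n M → T.Realizes f g δ → 𝒳 X → FiltN 𝒳 (n + 1) M'

variable {T} {𝒳 : ObjectProperty C}

lemma FiltN.of_iso {n : ℕ} {M N : C} (hM : T.FiltN 𝒳 n M) (e : M ≅ N) : T.FiltN 𝒳 n N := by
  cases hM with
  | zero h => exact .zero (h.of_iso e.symm)
  | step h hr hX => exact .step h (T.realizes_of_iso e rfl (e.hom_inv_id_assoc _) hr) hX

lemma FiltN.isZero {M : C} (hM : T.FiltN 𝒳 0 M) : IsZero M := by
  cases hM with
  | zero h => exact h

lemma filt_iff_exists_filtN {M : C} : T.Filt 𝒳 M ↔ ∃ n, T.FiltN 𝒳 n M := by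
  constructor
  · intro h
    induction h with
    | zero h => exact ⟨0, .zero h⟩
    | step _ hr hX ih => exact ⟨_, .step ih.choose_spec hr hX⟩
  · rintro ⟨n, h⟩
    induction h with
    | zero h => exact .zero h
    | step _ hr hX ih => exact .step ih hr hX

/-- Pull the extension back along the last step of the filtration of `M`, using (ET4)ᵒᵖ. -/
lemma FiltN.extension {m n : ℕ} {X L M : C} {x : X ⟶ L} {y : L ⟶ M}
    {δ : (T.E.obj (op M)).obj X} (hX : T.FiltN 𝒳 m X) (hM : T.FiltN 𝒳 n M)
    (h : T.Realizes x y δ) : T.FiltN 𝒳 (m + n) L := by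
  induction hM generalizing L with
  | zero hM =>
    have := h.isIso_of_isZero_right hM
    exact hX.of_iso (asIso x)
  | step _ hr hS ih =>
    obtain ⟨G, h', d, e, δ'', -, -, h1, h2, -, -⟩ := T.et4_op h hr
    exact .step (ih h2) h1 hS

lemma Filt.extension {X L M : C} {x : X ⟶ L} {y : L ⟶ M} {δ : (T.E.obj (op M)).obj X}
    (hX : T.Filt 𝒳 X) (hM : T.Filt 𝒳 M) (h : T.Realizes x y δ) : T.Filt 𝒳 L := by
  rw [filt_iff_exists_filtN] at hX hM ⊢
  exact ⟨_, hX.choose_spec.extension hM.choose_spec h⟩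

lemma Filt.of_prop {X : C} (hX : 𝒳 X) : T.Filt 𝒳 X :=
  .step (.zero (isZero_zero C)) (realizes_of_isZero_left (isZero_zero C) X) hX

lemma Filt.mono {𝒴 : ObjectProperty C} (h𝒳 : 𝒳 ≤ 𝒴) {M : C} (hM : T.Filt 𝒳 M) :
    T.Filt 𝒴 M := by
  induction hM with
  | zero h => exact .zero h
  | step _ hr hX ih => exact .step ih hr (h𝒳 _ hX)

lemma Filt.hom_eq_zero_of_leftOrthogonal {X M : C} (hM : T.Filt 𝒳 M)
    (hX : 𝒳.leftOrthogonal X) (f : X ⟶ M) : f = 0 := by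
  induction hM with
  | zero h => exact h.eq_of_tgt _ _
  | step _ hr hS ih =>
    obtain ⟨a, rfl⟩ := hr.exists_lift f (hX _ hS)
    rw [ih a, zero_comp]

lemma Filt.hom_eq_zero_of_rightOrthogonal {X M : C} (hM : T.Filt 𝒳 M)
    (hX : 𝒳.rightOrthogonal X) (f : M ⟶ X) : f = 0 := by
  induction hM with
  | zero h => exact h.eq_of_src _ _
  | step _ hr hS ih =>
    obtain ⟨c, rfl⟩ := hr.exists_desc f (ih _)
    rw [hX c hS, comp_zero]

end Filtrations

/-! ### Simple objects and the system attached to a length -/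

section Simple

variable {T} {Θ : C → ℕ}

/-- An object is simple with respect to `Θ` if it is not the middle term of a `Θ`-stable
`𝔼`-triangle with non-zero ends. -/
def IsSimpleFor (T : ExtriangulatedStructure.{w} C) (Θ : C → ℕ) (X : C) : Prop :=
  ∀ ⦃K I : C⦄ ⦃k : K ⟶ X⦄ ⦃i : X ⟶ I⦄ ⦃δ : (T.E.obj (op I)).obj K⦄,
    T.Realizes k i δ → Θ X = Θ K + Θ I → IsZero K ∨ IsZero I

/-- One half of Schur's lemma: in an admissible factorization, the deflation out of a simple object
is zero or invertible. -/
lemma IsSimpleFor.exists_iso_of_ne_zero (hΘ : T.IsLengthCategoryWith Θ) {X M : C}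
    (hX : T.IsSimpleFor Θ X) (f : X ⟶ M) (hf : f ≠ 0) :
    ∃ (I : C) (i : X ⟶ I) (j : I ⟶ M), IsIso i ∧ T.IsInflationFor Θ j ∧ i ≫ j = f := by
  obtain ⟨I, i, j, ⟨K, k, δ, hr, hl⟩, hj, rfl⟩ := hΘ.2 f
  refine ⟨I, i, j, ?_, hj, rfl⟩
  rcases hX hr hl with h | h
  · exact hr.isIso_of_isZero_left h
  · exact absurd (by rw [h.eq_of_tgt i 0, zero_comp]) hf

lemma IsSimpleFor.exists_iso_of_ne_zero' (hΘ : T.IsLengthCategoryWith Θ) {X M : C}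
    (hX : T.IsSimpleFor Θ X) (f : M ⟶ X) (hf : f ≠ 0) :
    ∃ (I : C) (i : M ⟶ I) (j : I ⟶ X), IsIso j ∧ T.IsDeflationFor Θ i ∧ i ≫ j = f := by
  obtain ⟨I, i, j, hi, ⟨K, k, δ, hr, hl⟩, rfl⟩ := hΘ.2 f
  refine ⟨I, i, j, ?_, hi, rfl⟩
  rcases hX hr hl with h | h
  · exact absurd (by rw [h.eq_of_src j 0, comp_zero]) hf
  · exact hr.isIso_of_isZero_right h

lemma IsSimpleFor.isIso_of_ne_zero (hΘ : T.IsLengthCategoryWith Θ) {X Y : C}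
    (hX : T.IsSimpleFor Θ X) (hY : T.IsSimpleFor Θ Y) (f : X ⟶ Y) (hf : f ≠ 0) : IsIso f := by
  obtain ⟨I, i, j, hi, ⟨K, k, δ, hr, hl⟩, rfl⟩ := hX.exists_iso_of_ne_zero hΘ f hf
  have : IsIso j := by
    rcases hY hr hl with h | h
    · exact absurd (by rw [h.eq_of_src j 0, comp_zero]) hf
    · exact hr.isIso_of_isZero_right h
  infer_instance

lemma thetaLevel_le_succ {C : Type u} [Category.{v} C] [Preadditive C] {Θ : C → ℕ} (n : ℕ) :
    thetaLevel Θ n ≤ thetaLevel Θ (n + 1) := by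
  intro M hM
  cases n with
  | zero => exact hM.elim
  | succ n => exact Or.inl hM

lemma thetaLevel_of_iso (hΘ : T.IsLengthFunction Θ) {n : ℕ} {M N : C} (e : M ≅ N)
    (hM : thetaLevel Θ n M) : thetaLevel Θ n N := by
  induction n with
  | zero => exact hM.elim
  | succ n ih =>
    cases n with
    | zero => exact ⟨fun h => hM.1 (h.of_iso e), fun P hP => hΘ.iso e ▸ hM.2 P hP⟩
    | succ n =>
      rcases hM with hM | ⟨h1, h2, h3⟩
      · exact Or.inl (ih hM)
      · exact Or.inr ⟨ObjectProperty.prop_of_iso _ e h1, ObjectProperty.prop_of_iso _ e h2,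
          hΘ.iso e ▸ h3⟩

lemma not_isZero_of_thetaLevel (hΘ : T.IsLengthFunction Θ) {n : ℕ} {M : C}
    (hM : thetaLevel Θ n M) : ¬ IsZero M := by
  induction n with
  | zero => exact hM.elim
  | succ n ih =>
    cases n with
    | zero => exact hM.1
    | succ n =>
      rcases hM with hM | ⟨-, -, h3⟩
      · exact ih hM
      · rw [← hΘ.eq_zero_iff]
        omega

/-- If every shorter object is filtered by `𝒳` and `X` has no non-zero morphism to an object
of `𝒳`, then `X` is simple. -/
lemma isSimpleFor_of_leftOrthogonal (hΘ : T.IsLengthFunction Θ) {𝒳 : ObjectProperty C} {X : C}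
    (hfilt : ∀ M : C, Θ M < Θ X → T.Filt 𝒳 M) (hX : 𝒳.leftOrthogonal X) :
    T.IsSimpleFor Θ X := by
  intro K I k i δ hr hl
  by_contra! h
  rw [← hΘ.eq_zero_iff, ← hΘ.eq_zero_iff] at h
  have hi : i = 0 := (hfilt I (by omega)).hom_eq_zero_of_leftOrthogonal hX i
  obtain ⟨s, hs⟩ := hr.exists_lift (𝟙 X) (by rw [hi, comp_zero])
  have hs0 : s = 0 := (hfilt K (by omega)).hom_eq_zero_of_leftOrthogonal hX s
  have hX0 : Θ X = 0 := by
    rw [hΘ.eq_zero_iff, IsZero.iff_id_eq_zero, ← hs, hs0, zero_comp]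
  omega

/-- The claims need each other: simplicity at one level yields the filtrations at the next, and
those filtrations make the objects added afterwards simple. -/
lemma filt_thetaLevel (hΘ : T.IsLengthCategoryWith Θ) (n : ℕ) :
    (∀ M : C, Θ M ≤ n → T.Filt (thetaLevel Θ n) M) ∧
      ∀ X : C, thetaLevel Θ n X → T.IsSimpleFor Θ X := by
  have hl := hΘ.1
  induction n with
  | zero => exact ⟨fun M hM => .zero ((hl.eq_zero_iff M).1 (by omega)), fun X hX => hX.elim⟩
  | succ n ih =>
    cases n with
    | zero =>
      constructor
      · intro M hM
        by_cases h0 : IsZero M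
        · exact .zero h0
        · refine .of_prop ⟨h0, fun N hN => ?_⟩
          rw [← hl.eq_zero_iff] at hN
          omega
      · intro X hX K I k i δ hr hs
        by_contra! h
        have h1 := hX.2 K h.1
        have h2 := h.2
        rw [← hl.eq_zero_iff] at h2
        omega
    | succ n =>
      constructor
      · intro M hM
        by_cases hle : Θ M ≤ n + 1
        · exact (ih.1 M hle).mono (thetaLevel_le_succ _)
        by_cases hR : (thetaLevel Θ (n + 1)).rightOrthogonal M
        · by_cases hL : (thetaLevel Θ (n + 1)).leftOrthogonal M
          · exact .of_prop (Or.inr ⟨hR, hL, by omega⟩)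
          · rw [ObjectProperty.leftOrthogonal_iff] at hL
            push Not at hL
            obtain ⟨X, f, hX, hf⟩ := hL
            obtain ⟨I, i, j, hj, ⟨K, k, δ, hr, hs⟩, -⟩ :=
              (ih.2 X hX).exists_iso_of_ne_zero' hΘ f hf
            have hI := thetaLevel_of_iso hl (asIso j).symm hX
            have hI0 := not_isZero_of_thetaLevel hl hI
            rw [← hl.eq_zero_iff] at hI0
            exact .step ((ih.1 K (by omega)).mono (thetaLevel_le_succ _)) hr (Or.inl hI)
        · rw [ObjectProperty.rightOrthogonal_iff] at hR
          push Not at hR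
          obtain ⟨X, f, hX, hf⟩ := hR
          obtain ⟨I, i, j, hi, ⟨K, k, δ, hr, hs⟩, -⟩ :=
            (ih.2 X hX).exists_iso_of_ne_zero hΘ f hf
          have hI := thetaLevel_of_iso hl (asIso i) hX
          have hI0 := not_isZero_of_thetaLevel hl hI
          rw [← hl.eq_zero_iff] at hI0
          -- Here the simple object is at the bottom and the shorter object is the cone, so closure
          -- under extensions is needed.
          exact (Filt.of_prop (thetaLevel_le_succ _ _ hI)).extension
            ((ih.1 K (by omega)).mono (thetaLevel_le_succ _)) hr
      · rintro X (hX | ⟨-, h2, h3⟩)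
        · exact ih.2 X hX
        · exact isSimpleFor_of_leftOrthogonal hl (fun M hM => ih.1 M (by omega)) h2

lemma isSimpleMindedSystem_thetaInfty (hΘ : T.IsLengthCategoryWith Θ) :
    T.IsSimpleMindedSystem (thetaInfty Θ) := by
  have hiso : ∀ X Y : C, thetaInfty Θ X → thetaInfty Θ Y → ∀ f : X ⟶ Y, f ≠ 0 → IsIso f := by
    rintro X Y ⟨m, -, hX⟩ ⟨n, -, hY⟩ f hf
    exact ((filt_thetaLevel hΘ m).2 X hX).isIso_of_ne_zero hΘ ((filt_thetaLevel hΘ n).2 Y hY) f hf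
  refine ⟨⟨⟨fun e ⟨n, hn, h⟩ => ⟨n, hn, thetaLevel_of_iso hΘ.1 e h⟩⟩, ?_, ?_⟩, ?_⟩
  · intro X hX
    refine ⟨⟨𝟙 X, 0, ?_⟩, fun f hf => ?_⟩
    · obtain ⟨n, -, h⟩ := hX
      intro h0
      exact not_isZero_of_thetaLevel hΘ.1 h ((IsZero.iff_id_eq_zero X).2 h0)
    · exact (isUnit_iff_isIso f).2 (hiso X X hX hX f hf)
  · intro X Y hX hY hXY f
    by_contra hf
    have := hiso X Y hX hY f hf
    exact hXY.false (asIso f)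
  · intro M
    -- Level `Θ M` would do except when it is `0`, which `thetaInfty` excludes.
    exact ((filt_thetaLevel hΘ (Θ M + 1)).1 M (by omega)).mono
      fun X hX => ⟨_, by omega, hX⟩

end Simple

/-! ### The length attached to a simple-minded system -/

section SimpleMinded

variable {T} {𝒳 : ObjectProperty C}

lemma IsSemibrick.isIso_of_ne_zero {C : Type u} [Category.{v} C] [Preadditive C]
    {𝒳 : ObjectProperty C} (h𝒳 : IsSemibrick 𝒳) {X Y : C} (hX : 𝒳 X) (hY : 𝒳 Y) (f : X ⟶ Y) (hf : f ≠ 0) : IsIso f := by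
  by_cases hXY : IsEmpty (X ≅ Y)
  · exact absurd (h𝒳.hom_eq_zero X Y hX hY hXY f) hf
  · rw [not_isEmpty_iff] at hXY
    obtain ⟨e⟩ := hXY
    have h1 : IsIso (f ≫ e.inv) := by
      refine (isUnit_iff_isIso (f ≫ e.inv)).1 ((h𝒳.brick X hX).2 _ fun h0 => hf ?_)
      have h0' : f ≫ e.inv = 0 := h0
      rw [← cancel_mono e.inv, h0', zero_comp]
    exact IsIso.of_isIso_comp_right f e.inv

/-- A non-zero morphism from an object of a semibrick `𝒳` to an object filtered by `𝒳` is an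
inflation, and its cone has a shorter filtration. -/
lemma FiltN.exists_realizes_of_ne_zero (h𝒳 : IsSemibrick 𝒳) {n : ℕ} {X M : C}
    (hM : T.FiltN 𝒳 n M) (hX : 𝒳 X) (f : X ⟶ M) (hf : f ≠ 0) :
    ∃ (k : ℕ) (M' : C) (g : M ⟶ M') (δ : (T.E.obj (op M')).obj X),
      k + 1 = n ∧ T.FiltN 𝒳 k M' ∧ T.Realizes f g δ := by
  induction hM with
  | zero h => exact absurd (h.eq_of_tgt f 0) hf
  | @step n _ _ _ _ g _ hA hr hS ih =>
    -- If `f` vanishes on the top factor, it comes from the previous stage, and (ET4) puts that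
    -- factor on top of the cone found there. Otherwise it maps isomorphically onto the top factor
    -- and splits the last step.
    by_cases hfg : f ≫ g = 0
    · obtain ⟨a, rfl⟩ := hr.exists_lift f hfg
      obtain ⟨k, N, p, ε, rfl, hN, hp⟩ := ih a (fun h => hf (by rw [h, zero_comp]))
      obtain ⟨G, h', d, e, δ'', -, -, h1, h2, -, -⟩ := T.et4 hp hr
      exact ⟨k + 1, G, h', δ'', rfl, .step hN h2 hS, h1⟩
    · have := h𝒳.isIso_of_ne_zero hX hS _ hfg
      obtain ⟨r, hr'⟩ := hr.exists_realizes_of_isIso_comp f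
      exact ⟨n, _, r, 0, rfl, hA, hr'⟩

lemma Filt.exists_ne_zero {M : C} (hM : T.Filt 𝒳 M) (h0 : ¬ IsZero M) :
    ∃ (X : C) (f : X ⟶ M), 𝒳 X ∧ f ≠ 0 := by
  by_contra! h
  exact h0 ((IsZero.iff_id_eq_zero M).2
    (hM.hom_eq_zero_of_rightOrthogonal (fun X f hX => h X f hX) (𝟙 M)))

lemma IsSimpleMindedSystem.exists_filtN (h𝒳 : T.IsSimpleMindedSystem 𝒳) (M : C) :
    ∃ n, T.FiltN 𝒳 n M :=
  filt_iff_exists_filtN.1 (h𝒳.2 M)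

/-- The cone of `X ⟶ M ⟶ M ⊞ N` is computed twice: it has a filtration with one step fewer, and by
(ET4) it is `M' ⊞ N` with `M'` the cone of `X ⟶ M`. -/
lemma FiltN.exists_of_biprod (h𝒳 : T.IsSimpleMindedSystem 𝒳) {n : ℕ} {M N : C}
    (h : T.FiltN 𝒳 n (M ⊞ N)) : ∃ a b, a + b = n ∧ T.FiltN 𝒳 a M ∧ T.FiltN 𝒳 b N := by
  induction n generalizing M with
  | zero =>
    have h0 := h.isZero
    refine ⟨0, 0, rfl, .zero ?_, .zero ?_⟩
    · rw [IsZero.iff_id_eq_zero, ← biprod.inl_fst (X := M) (Y := N), h0.eq_of_tgt biprod.inl 0,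
        zero_comp]
    · rw [IsZero.iff_id_eq_zero, ← biprod.inr_snd (X := M) (Y := N), h0.eq_of_tgt biprod.inr 0,
        zero_comp]
  | succ n ih =>
    by_cases hM : IsZero M
    · have := (T.realizes_zero M N).isIso_of_isZero_left hM
      exact ⟨0, n + 1, by omega, .zero hM, h.of_iso (asIso biprod.snd)⟩
    obtain ⟨X, f, hX, hf⟩ := (h𝒳.2 M).exists_ne_zero hM
    obtain ⟨m, hMm⟩ := h𝒳.exists_filtN M
    obtain ⟨_, M', g, δ, -, -, hr⟩ := hMm.exists_realizes_of_ne_zero h𝒳.1 hX f hf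
    obtain ⟨k, Q, p, ε, hk, hQ, hp⟩ := h.exists_realizes_of_ne_zero h𝒳.1 hX (f ≫ biprod.inl)
      (fun h0 => hf (by rw [← cancel_mono (biprod.inl : M ⟶ M ⊞ N), h0, zero_comp]))
    obtain rfl : k = n := by omega
    obtain ⟨G, h', d, e, δ'', -, -, h1, h2, -, -⟩ := T.et4 hr (T.realizes_zero M N)
    rw [map_zero] at h2
    obtain ⟨i⟩ := hp.nonempty_iso_cone h1
    obtain ⟨j, -, -⟩ := h2.exists_biprod_iso
    obtain ⟨a, b, hab, ha, hb⟩ := ih (hQ.of_iso (i ≪≫ j))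
    have hX1 : T.FiltN 𝒳 1 X :=
      .step (.zero (isZero_zero C)) (realizes_of_isZero_left (isZero_zero C) X) hX
    exact ⟨1 + a, b, by omega, hX1.extension ha hr, hb⟩

open Classical in
/-- The least number of steps of a filtration with cones in `𝒳`. -/
noncomputable def filtLength (h𝒳 : T.IsSimpleMindedSystem 𝒳) (M : C) : ℕ :=
  Nat.find (h𝒳.exists_filtN M)

lemma filtN_filtLength (h𝒳 : T.IsSimpleMindedSystem 𝒳) (M : C) :
    T.FiltN 𝒳 (filtLength h𝒳 M) M := by
  classical
  exact Nat.find_spec (h𝒳.exists_filtN M)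

lemma filtLength_le (h𝒳 : T.IsSimpleMindedSystem 𝒳) {n : ℕ} {M : C} (h : T.FiltN 𝒳 n M) :
    filtLength h𝒳 M ≤ n := by
  classical
  exact Nat.find_min' (h𝒳.exists_filtN M) h

lemma filtLength_le_of_iso (h𝒳 : T.IsSimpleMindedSystem 𝒳) {M N : C} (e : M ≅ N) :
    filtLength h𝒳 N ≤ filtLength h𝒳 M :=
  filtLength_le h𝒳 ((filtN_filtLength h𝒳 M).of_iso e)

lemma isLengthFunction_filtLength (h𝒳 : T.IsSimpleMindedSystem 𝒳) :
    T.IsLengthFunction (filtLength h𝒳) where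
  iso e := le_antisymm (filtLength_le_of_iso h𝒳 e.symm) (filtLength_le_of_iso h𝒳 e)
  eq_zero_iff X := by
    constructor
    · intro h
      exact (h ▸ filtN_filtLength h𝒳 X : T.FiltN 𝒳 0 X).isZero
    · intro h
      exact Nat.le_zero.1 (filtLength_le h𝒳 (.zero h))
  le_add h := filtLength_le h𝒳 ((filtN_filtLength h𝒳 _).extension (filtN_filtLength h𝒳 _) h)
  eq_add_of_split {X L M x y} h := by
    refine le_antisymm
      (filtLength_le h𝒳 ((filtN_filtLength h𝒳 _).extension (filtN_filtLength h𝒳 _) h)) ?_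
    obtain ⟨e, -, -⟩ := h.exists_biprod_iso
    obtain ⟨a, b, hab, ha, hb⟩ := ((filtN_filtLength h𝒳 L).of_iso e).exists_of_biprod h𝒳
    have := filtLength_le h𝒳 ha
    have := filtLength_le h𝒳 hb
    omega

/-- The cone has a filtration one step shorter than a minimal one of `M`, so subadditivity forces
equality throughout. -/
lemma exists_realizes_filtLength (h𝒳 : T.IsSimpleMindedSystem 𝒳) {X M : C} (hX : 𝒳 X)
    (f : X ⟶ M) (hf : f ≠ 0) :
    ∃ (M' : C) (g : M ⟶ M') (δ : (T.E.obj (op M')).obj X), T.Realizes f g δ ∧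
      filtLength h𝒳 X = 1 ∧ filtLength h𝒳 M = 1 + filtLength h𝒳 M' := by
  obtain ⟨k, M', g, δ, hk, hM', hr⟩ :=
    (filtN_filtLength h𝒳 M).exists_realizes_of_ne_zero h𝒳.1 hX f hf
  refine ⟨M', g, δ, hr, ?_⟩
  have hl := isLengthFunction_filtLength h𝒳
  have hX1 : T.FiltN 𝒳 1 X :=
    .step (.zero (isZero_zero C)) (realizes_of_isZero_left (isZero_zero C) X) hX
  have h1 := filtLength_le h𝒳 hX1
  have h2 := filtLength_le h𝒳 hM'
  have h3 := hl.le_add hr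
  omega

lemma IsDeflationFor.comp {Θ : C → ℕ} (hΘ : T.IsLengthFunction Θ) {L M N : C} {y : L ⟶ M}
    {z : M ⟶ N} (hy : T.IsDeflationFor Θ y) (hz : T.IsDeflationFor Θ z) :
    T.IsDeflationFor Θ (y ≫ z) := by
  obtain ⟨X, x, δ, hr, hl⟩ := hy
  obtain ⟨Y, x', δ', hr', hl'⟩ := hz
  obtain ⟨G, h', d, e, δ'', -, -, h1, h2, -, -⟩ := T.et4_op hr hr'
  have h3 := hΘ.le_add h1
  have h4 := hΘ.le_add h2
  exact ⟨G, h', δ'', h1, by omega⟩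

lemma IsDeflationFor.id {Θ : C → ℕ} (hΘ : T.IsLengthFunction Θ) (M : C) :
    T.IsDeflationFor Θ (𝟙 M) := by
  have h := realizes_of_isZero_left (T := T) (isZero_zero C) M
  exact ⟨_, _, _, h, hΘ.eq_add_of_split h⟩

/-- Let `x` be an inflation from a brick such that `x ≫ f` is an inflation. If the morphism
induced by `f` on the cones is an inflation, so is `f`. -/
lemma exists_realizes_of_cone {X M M' N N' R : C} (hX : IsBrick X) {x : X ⟶ M} {y : M ⟶ M'}
    {δ : (T.E.obj (op M')).obj X} (h : T.Realizes x y δ) {f : M ⟶ N} (hxf : x ≫ f ≠ 0)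
    {q : N ⟶ N'} {ε : (T.E.obj (op N')).obj X} (h' : T.Realizes (x ≫ f) q ε) {f' : M' ⟶ N'}
    (hff' : f ≫ q = y ≫ f') (hδ : δ = (T.E.map f'.op).app X ε) {p : N' ⟶ R}
    {η : (T.E.obj (op R)).obj M'} (hf' : T.Realizes f' p η) :
    ∃ (R' : C) (g : N ⟶ R') (ξ : (T.E.obj (op R')).obj M),
      T.Realizes f g ξ ∧ Nonempty (R' ≅ R) := by
  -- The pullback `G` realizes `δ`, hence is isomorphic to `M`; this gives an inflation `M ⟶ N` with
  -- cone `R`, to be compared with `f`.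
  obtain ⟨G, l, d, e, ξ, hle, hdl, h1, h2, -, -⟩ := T.et4_op h' hf'
  rw [← hδ] at h2
  obtain ⟨i, hi, hi'⟩ := T.exists_iso_of_realizes h h2
  have hxD : x ≫ (f - i.hom ≫ l) = 0 := by
    rw [Preadditive.comp_sub, ← Category.assoc, hi, hdl, sub_self]
  obtain ⟨D, hD⟩ := h'.exists_lift (f - i.hom ≫ l) (by
    rw [Preadditive.sub_comp, Category.assoc, hle, hff', ← Category.assoc i.hom, hi', sub_self])
  -- A non-zero `x ≫ D` would be invertible in `End X`, yet it annihilates `x ≫ f`.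
  have hxD0 : x ≫ D = 0 := by
    by_contra hne
    have := (isUnit_iff_isIso (x ≫ D)).1 (hX.2 (x ≫ D) hne)
    rw [← hD, ← Category.assoc] at hxD
    exact hxf ((cancel_epi (x ≫ D)).1 (by rw [hxD, comp_zero]))
  have hu : IsIso (𝟙 M + D ≫ x) := by
    refine isIso_of_sub_comp_self_eq_zero _ ?_
    simp [reassoc_of% hxD0]
  have hf : f = ((𝟙 M + D ≫ x) ≫ i.hom) ≫ l := by
    rw [Preadditive.add_comp, Category.id_comp, Category.assoc D, hi, Preadditive.add_comp,
      Category.assoc D, hdl, hD]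
    abel
  rw [hf]
  exact h1.exists_of_isIso_comp _

/-- A morphism that kills no non-zero morphism from an object of `𝒳` is an inflation, stable
for the filtration length. -/
lemma isInflationFor_filtLength (h𝒳 : T.IsSimpleMindedSystem 𝒳) {M N : C} (f : M ⟶ N)
    (hf : ∀ (X : C) (g : X ⟶ M), 𝒳 X → g ≫ f = 0 → g = 0) :
    T.IsInflationFor (filtLength h𝒳) f := by
  have hl := isLengthFunction_filtLength h𝒳
  induction hn : filtLength h𝒳 M generalizing M N with
  | zero =>
    have h0 := (hl.eq_zero_iff M).1 hn
    have h := realizes_of_isZero_left (T := T) h0 N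
    rw [h0.eq_of_src 0 f] at h
    exact ⟨_, _, _, h, hl.eq_add_of_split h⟩
  | succ n ih =>
    obtain ⟨X, x, hX, hx⟩ := (h𝒳.2 M).exists_ne_zero (by rw [← hl.eq_zero_iff]; omega)
    have hxf : x ≫ f ≠ 0 := fun h0 => hx (hf X x hX h0)
    obtain ⟨M', y, δ, hr, hX1, hM'⟩ := exists_realizes_filtLength h𝒳 hX x hx
    obtain ⟨N', q, ε, hr', -, hN'⟩ := exists_realizes_filtLength h𝒳 hX (x ≫ f) hxf
    obtain ⟨f', hff', hδ⟩ := T.et3 hr hr' (𝟙 X) f (by simp)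
    have hδ' : δ = (T.E.map f'.op).app X ε := by simpa using hδ
    -- The hypothesis passes to `f'`: a morphism `g` killed by `f'` lifts to some `b` because `δ` is
    -- pulled back from `ε`. Subtracting a morphism through `x` makes `b` killed by `f`, hence zero,
    -- so `g = 0`.
    obtain ⟨R, p, η, hp, hR⟩ := ih f' (fun Y g hY hg => by
      obtain ⟨b, rfl⟩ := hr.exists_lift_of_pullback_eq_zero g (by
        rw [hδ', ← map_op_comp_app, hg, map_op_zero_app])
      rw [Category.assoc, ← hff', ← Category.assoc] at hg
      obtain ⟨t, ht⟩ := hr'.exists_lift _ hg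
      have hb : b - t ≫ x = 0 := hf Y _ hY (by
        rw [Preadditive.sub_comp, ← ht, Category.assoc, sub_self])
      rw [sub_eq_zero.1 hb, Category.assoc, hr.comp_eq_zero, comp_zero]) (by omega)
    obtain ⟨R', g, ξ, hg, ⟨i⟩⟩ :=
      exists_realizes_of_cone (h𝒳.1.brick X hX) hr hxf hr' hff' hδ' hp
    have := hl.iso i
    exact ⟨R', g, ξ, hg, by omega⟩

lemma isAdmissibleFor_filtLength (h𝒳 : T.IsSimpleMindedSystem 𝒳) {M N : C} (f : M ⟶ N) :
    T.IsAdmissibleFor (filtLength h𝒳) f := by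
  have hl := isLengthFunction_filtLength h𝒳
  induction hn : filtLength h𝒳 M using Nat.strong_induction_on generalizing M with
  | _ n ih =>
    by_cases h : ∀ (X : C) (g : X ⟶ M), 𝒳 X → g ≫ f = 0 → g = 0
    · exact ⟨M, 𝟙 M, f, .id hl M, isInflationFor_filtLength h𝒳 f h, Category.id_comp f⟩
    · push Not at h
      obtain ⟨X, g, hX, hgf, hg⟩ := h
      obtain ⟨M', y, δ, hr, hX1, hM'⟩ := exists_realizes_filtLength h𝒳 hX g hg
      obtain ⟨f', rfl⟩ := hr.exists_desc f hgf
      obtain ⟨I, i, j, hi, hj, rfl⟩ := ih _ (by omega) f' rfl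
      exact ⟨I, y ≫ i, j, .comp hl ⟨X, g, δ, hr, by omega⟩ hi, hj, Category.assoc _ _ _⟩

end SimpleMinded

end ExtriangulatedStructure

theorem theorem3 {C : Type u} [Category.{v} C] [Preadditive C] [HasZeroObject C]
    [HasBinaryBiproducts C] (T : ExtriangulatedStructure.{w} C) :
    (T.IsLengthCategory ↔ ∃ 𝒳 : ObjectProperty C, T.IsSimpleMindedSystem 𝒳) ∧
      ∀ Θ : C → ℕ, T.IsLengthCategoryWith Θ →
        T.IsSimpleMindedSystem (ExtriangulatedStructure.thetaInfty Θ) :=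
  ⟨⟨fun ⟨_, hΘ⟩ => ⟨_, ExtriangulatedStructure.isSimpleMindedSystem_thetaInfty hΘ⟩,
    fun ⟨_, h𝒳⟩ => ⟨_, ExtriangulatedStructure.isLengthFunction_filtLength h𝒳,
      fun f => ExtriangulatedStructure.isAdmissibleFor_filtLength h𝒳 f⟩⟩,
    fun _ hΘ => ExtriangulatedStructure.isSimpleMindedSystem_thetaInfty hΘ⟩
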